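/- For $4\le n\le 8$ let $L_0$ be the free $\mathbb{Z}$-module with basis $E_0,\dots,E_n$, endowed with the scalar product defined by $E_0^2=-1$, $E_i^2=1$ for $i\ge 1$ and $E_i\cdot E_j=0$ for $i\ne j$. Let $K=3E_0-\sum_{i\ge 1}E_i$ and let $L=K^{\perp}\subset L_0$; this is an even lattice, of type $A_4,D_5,E_6,E_7,E_8$ for $n=4,5,6,7,8$ respectively. Let $\mathrm{O}(L)$ be the group of automorphisms of $L$ preserving the scalar product, and let $W\subset \mathrm{O}(L)$ be the Weyl group of $L$, that is, the subgroup generated by the reflections $v\mapsto v-(\alpha\cdot v)\,\alpha$, where $\alpha\in L$, $\alpha^2=2$. Let $L_2=L/2L$, endowed with the quadratic form $q$ over $\mathbb{F}_2$ induced by $v\mapsto\frac12 v^2$, let $\mathrm{O}(L_2)$ be the group of linear automorphisms of $L_2$ preserving $q$, and let $\rho:\mathrm{O}(L)\to \mathrm{O}(L_2)$ be the homomorphism given by reduction mod $2$. Then: 1. for $n=4,5,6$, $\rho$ induces an isomorphism of $W$ onto $\mathrm{O}(L_2)$; 2. for $n=7,8$, $-1$ belongs to $W$ and $\rho$ induces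 an isomorphism of $W/\{\pm1\}$ onto $\mathrm{O}(L_2)$. -/

import Mathlib

namespace DelPezzo

/-- The Lorentzian scalar product on the free `ℤ`-module `L₀` with basis `E_0, …, E_n`:
`E_0² = -1`, `E_i² = 1` for `i ≥ 1`, and `E_i · E_j = 0` for `i ≠ j`. -/
def lorentz (n : ℕ) : LinearMap.BilinForm ℤ (Fin (n + 1) → ℤ) :=
  LinearMap.mk₂ ℤ (fun v w => -(v 0 * w 0) + ∑ i : Fin n, v i.succ * w i.succ)
    (fun v v' w => by
      simp only [Pi.add_apply, add_mul, Finset.sum_add_distrib]; ring)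
    (fun c v w => by
      simp only [Pi.smul_apply, smul_eq_mul, mul_assoc, mul_add, Finset.mul_sum]; ring)
    (fun v w w' => by
      simp only [Pi.add_apply, mul_add, Finset.sum_add_distrib]; ring)
    (fun c v w => by
      simp only [Pi.smul_apply, smul_eq_mul, mul_left_comm _ c, mul_add, Finset.mul_sum]; ring)

theorem lorentz_apply (n : ℕ) (v w : Fin (n + 1) → ℤ) :
    lorentz n v w = -(v 0 * w 0) + ∑ i : Fin n, v i.succ * w i.succ := rfl

theorem lorentz_comm (n : ℕ) (v w : Fin (n + 1) → ℤ) : lorentz n v w = lorentz n w v := by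
  simp only [lorentz_apply, mul_comm]

/-- The vector `K = 3 E_0 - ∑_{i ≥ 1} E_i`. -/
def K (n : ℕ) : Fin (n + 1) → ℤ := Fin.cons 3 (fun _ => -1)

/-- The del Pezzo lattice `L = K^⊥ ⊆ L₀`. -/
def lattice (n : ℕ) : Submodule ℤ (Fin (n + 1) → ℤ) := LinearMap.ker (lorentz n (K n))

/-- The scalar product of `L`. -/
def form (n : ℕ) : LinearMap.BilinForm ℤ (lattice n) := (lorentz n).restrict (lattice n)

theorem form_apply (n : ℕ) (v w : lattice n) :
    form n v w = lorentz n (v : Fin (n + 1) → ℤ) (w : Fin (n + 1) → ℤ) := rfl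

theorem form_comm (n : ℕ) (v w : lattice n) : form n v w = form n w v := lorentz_comm n _ _

/-- `L` is an even lattice. -/
theorem even_form_self (n : ℕ) (v : lattice n) : Even (form n v v) := by
  obtain ⟨v, hv⟩ := v
  have hv' : lorentz n (K n) v = 0 := hv
  have key : ∀ a : ℤ, Even (a * a - a) := fun a => by
    have := Int.even_mul_pred_self a
    rwa [mul_sub, mul_one] at this
  have h1 : Even (∑ i : Fin n, (v i.succ * v i.succ - v i.succ)) :=
    Finset.even_sum _ fun i _ => key _
  have h2 := key (v 0)
  have h3 : -(3 * v 0) - ∑ i : Fin n, v i.succ = 0 := by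
    have : lorentz n (K n) v = -(3 * v 0) - ∑ i : Fin n, v i.succ := by
      simp [lorentz_apply, K, sub_eq_add_neg]
    rw [← this, hv']
  change Even (lorentz n v v)
  rw [lorentz_apply]
  rw [Finset.sum_sub_distrib] at h1
  obtain ⟨a, ha⟩ := h1
  obtain ⟨b, hb⟩ := h2
  exact ⟨a - b - 2 * v 0, by linarith⟩

/-- `v ↦ ½ v²` on `L`; the division is exact because `L` is even. -/
def halfSq (n : ℕ) (v : lattice n) : ℤ := form n v v / 2

theorem two_mul_halfSq (n : ℕ) (v : lattice n) : 2 * halfSq n v = form n v v :=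
  Int.mul_ediv_cancel' (even_form_self n v).two_dvd

theorem halfSq_add (n : ℕ) (v w : lattice n) :
    halfSq n (v + w) = halfSq n v + halfSq n w + form n v w := by
  have h1 := two_mul_halfSq n (v + w)
  have h2 := two_mul_halfSq n v
  have h3 := two_mul_halfSq n w
  have h4 := form_comm n v w
  simp only [map_add, LinearMap.add_apply] at h1
  linarith

theorem halfSq_two_smul (n : ℕ) (v : lattice n) : halfSq n ((2 : ℤ) • v) = 4 * halfSq n v := by
  have h1 := two_mul_halfSq n ((2 : ℤ) • v)
  have h2 := two_mul_halfSq n v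
  simp only [map_smul, LinearMap.smul_apply, smul_eq_mul] at h1
  linarith

/-- The vector space `L₂ = L / 2L` over the field with two elements. -/
abbrev latticeMod2 (n : ℕ) : Type := ModN (lattice n) 2

/-- The class in `L₂ = L / 2L` of a vector of `L`. -/
abbrev red (n : ℕ) : lattice n →+ latticeMod2 n := ModN.mkQ 2

theorem red_surjective (n : ℕ) : Function.Surjective (red n) := Submodule.mkQ_surjective _

theorem red_eq_iff (n : ℕ) (v w : lattice n) :
    red n v = red n w ↔ ∃ z : lattice n, w = v + (2 : ℤ) • z := by
  have h : red n w = red n v ↔ w - v ∈ LinearMap.range (LinearMap.lsmul ℤ (lattice n) (2 : ℕ)) :=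
    Submodule.Quotient.eq _
  rw [eq_comm, h]
  constructor
  · rintro ⟨z, hz⟩
    refine ⟨z, ?_⟩
    have hz' : (2 : ℤ) • z = w - v := hz
    rw [hz']; abel
  · rintro ⟨z, rfl⟩
    refine ⟨z, ?_⟩
    change (2 : ℤ) • z = _
    abel

/-- The underlying function of the quadratic form on `L / 2L` induced by `v ↦ ½ v²`. -/
def qFun (n : ℕ) : latticeMod2 n → ZMod 2 :=
  Quotient.lift (s := Submodule.quotientRel _) (fun v : lattice n => (halfSq n v : ZMod 2)) (by
    intro v w h
    have h' : red n v = red n w := Quotient.sound h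
    obtain ⟨z, rfl⟩ := (red_eq_iff n v w).1 h'
    have h2 : (2 : ZMod 2) = 0 := rfl
    have h4 : (4 : ZMod 2) = 0 := rfl
    rw [halfSq_add, halfSq_two_smul, map_smul]
    push_cast [smul_eq_mul]
    simp [h2, h4])

theorem qFun_red (n : ℕ) (v : lattice n) : qFun n (red n v) = (halfSq n v : ZMod 2) := rfl

theorem polar_qFun_red (n : ℕ) (v w : lattice n) :
    QuadraticMap.polar (qFun n) (red n v) (red n w) = (form n v w : ZMod 2) := by
  rw [QuadraticMap.polar, ← map_add, qFun_red, qFun_red, qFun_red, halfSq_add]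
  push_cast; ring

/-- The quadratic form `q` on the `𝔽₂`-vector space `L₂ = L / 2L` induced by `v ↦ ½ v²`. -/
def q (n : ℕ) : QuadraticForm (ZMod 2) (latticeMod2 n) :=
  have hz : qFun n 0 = 0 := by
    rw [← map_zero (red n), qFun_red]; simp [halfSq]
  have ha : ∀ a : ZMod 2, a = 0 ∨ a = 1 := by decide
  QuadraticMap.ofPolar (qFun n)
    (fun a x => by
      obtain rfl | rfl := ha a <;> simp [hz])
    (fun x x' y => by
      obtain ⟨x, rfl⟩ := red_surjective n x
      obtain ⟨x', rfl⟩ := red_surjective n x'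
      obtain ⟨y, rfl⟩ := red_surjective n y
      rw [← map_add, polar_qFun_red, polar_qFun_red, polar_qFun_red]
      simp)
    (fun a x y => by
      obtain rfl | rfl := ha a
      · simp [QuadraticMap.polar, hz]
      · simp)

theorem q_red (n : ℕ) (v : lattice n) : q n (red n v) = (halfSq n v : ZMod 2) := rfl

/-- `O(L)`: the group of automorphisms of `L` that preserve its scalar product. -/
def orthL (n : ℕ) : Subgroup (lattice n ≃ₗ[ℤ] lattice n) where
  carrier := {u | ∀ v w, form n (u v) (u w) = form n v w}
  mul_mem' := fun {a b} ha hb v w => (ha (b v) (b w)).trans (hb v w)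
  one_mem' := fun _ _ => rfl
  inv_mem' := fun {a} ha v w => by
    have h := ha (a⁻¹ v) (a⁻¹ w)
    rw [show a (a⁻¹ v) = v from a.apply_symm_apply v,
      show a (a⁻¹ w) = w from a.apply_symm_apply w] at h
    exact h.symm

/-- `O(L₂)`: the group of linear automorphisms of `L₂` that preserve the quadratic form `q`. -/
def orthL2 (n : ℕ) : Subgroup (latticeMod2 n ≃ₗ[ZMod 2] latticeMod2 n) where
  carrier := {g | ∀ x, q n (g x) = q n x}
  mul_mem' := fun {a b} ha hb x => (ha (b x)).trans (hb x)
  one_mem' := fun _ => rfl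
  inv_mem' := fun {a} ha x => by
    have h := ha (a⁻¹ x)
    rw [show a (a⁻¹ x) = x from a.apply_symm_apply x] at h
    exact h.symm

/-- The endomorphism of `L / 2L` induced by an endomorphism of `L`. -/
def redMap (n : ℕ) (u : lattice n →+ lattice n) : latticeMod2 n →ₗ[ZMod 2] latticeMod2 n :=
  ModN.liftEquiv'.symm ⟨(red n).comp u, fun v => by
    rw [← map_nsmul, ← map_zero ((red n).comp u)]
    refine ((red_eq_iff n _ _).2 ⟨u v, ?_⟩).symm
    rw [map_zero, zero_add, map_nsmul, two_nsmul, two_smul]⟩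

theorem redMap_red (n : ℕ) (u : lattice n →+ lattice n) (v : lattice n) :
    redMap n u (red n v) = red n (u v) := rfl

theorem redMap_comp_eq_id (n : ℕ) (u u' : lattice n →+ lattice n) (h : ∀ v, u (u' v) = v) :
    (redMap n u).comp (redMap n u') = LinearMap.id := by
  refine LinearMap.ext fun x => ?_
  obtain ⟨v, rfl⟩ := red_surjective n x
  rw [LinearMap.comp_apply, redMap_red, redMap_red, h, LinearMap.id_apply]

/-- The automorphism of `L / 2L` induced by an automorphism of `L`. -/
def redEquiv (n : ℕ) (u : lattice n ≃ₗ[ℤ] lattice n) : latticeMod2 n ≃ₗ[ZMod 2] latticeMod2 n :=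
  LinearEquiv.ofLinearMap (redMap n u.toAddEquiv.toAddMonoidHom)
    (redMap n u.symm.toAddEquiv.toAddMonoidHom)
    (redMap_comp_eq_id n _ _ u.apply_symm_apply)
    (redMap_comp_eq_id n _ _ u.symm_apply_apply)

theorem redEquiv_red (n : ℕ) (u : lattice n ≃ₗ[ℤ] lattice n) (v : lattice n) :
    redEquiv n u (red n v) = red n (u v) := rfl

theorem redEquiv_mem (n : ℕ) (u : orthL n) : redEquiv n u ∈ orthL2 n := by
  intro x
  obtain ⟨v, rfl⟩ := red_surjective n x
  rw [redEquiv_red, q_red, q_red, halfSq, halfSq, u.2 v v]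

/-- The reduction homomorphism `ρ : O(L) → O(L₂)`. -/
def rho (n : ℕ) : orthL n →* orthL2 n where
  toFun u := ⟨redEquiv n u, redEquiv_mem n u⟩
  map_one' := by
    refine Subtype.ext (LinearEquiv.ext fun x => ?_)
    obtain ⟨v, rfl⟩ := red_surjective n x
    rfl
  map_mul' a b := by
    refine Subtype.ext (LinearEquiv.ext fun x => ?_)
    obtain ⟨v, rfl⟩ := red_surjective n x
    rfl

theorem rho_red (n : ℕ) (u : orthL n) (v : lattice n) :
    (rho n u : latticeMod2 n ≃ₗ[ZMod 2] latticeMod2 n) (red n v) =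
      red n ((u : lattice n ≃ₗ[ℤ] lattice n) v) := rfl

/-- The root system `R`: the vectors of `L` of square `2`. -/
def roots (n : ℕ) : Set (lattice n) := {a | form n a a = 2}

/-- The reflection `v ↦ v - (a · v) a` of `L` attached to a root `a`. -/
def rootReflection (n : ℕ) (a : roots n) : orthL n :=
  ⟨Module.reflection (x := (a : lattice n)) (f := form n a)
    (show form n (a : lattice n) (a : lattice n) = 2 from a.2), fun v w => by
    have h : form n a a = 2 := a.2
    simp only [Module.reflection_apply, map_sub, LinearMap.sub_apply, map_smul,
      LinearMap.smul_apply, smul_eq_mul, h, form_comm n v a]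
    ring⟩

theorem rootReflection_apply (n : ℕ) (a : roots n) (v : lattice n) :
    (rootReflection n a : lattice n ≃ₗ[ℤ] lattice n) v = v - form n a v • (a : lattice n) :=
  rfl

/-- The Weyl group `W` of `L`: the subgroup of `O(L)` generated by the reflections in the roots. -/
def weyl (n : ℕ) : Subgroup (orthL n) := Subgroup.closure (Set.range (rootReflection n))

/-- The element `-1` of `O(L)`. -/
def negOne (n : ℕ) : orthL n := ⟨LinearEquiv.neg ℤ, fun v w => by simp⟩

theorem negOne_mul_self (n : ℕ) : negOne n * negOne n = 1 := by
  ext v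
  simp [negOne]

/-- The subgroup `{±1}` of `O(L)`. -/
def pmOne (n : ℕ) : Subgroup (orthL n) where
  carrier := {1, negOne n}
  mul_mem' := by
    rintro a b (rfl | rfl) (rfl | rfl) <;> simp [negOne_mul_self]
  one_mem' := Or.inl rfl
  inv_mem' := by
    rintro a (rfl | rfl)
    · simp
    · exact Or.inr (inv_eq_of_mul_eq_one_left (negOne_mul_self n))

instance pmOne_normal (n : ℕ) : (pmOne n).Normal where
  conj_mem := by
    rintro a (rfl | rfl) g
    · rw [mul_one, mul_inv_cancel]
      exact (pmOne n).one_mem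
    · have h : g * negOne n = negOne n * g := by
        ext v
        simp [negOne]
      rw [h, mul_inv_cancel_right]
      exact Or.inr rfl

end DelPezzo

namespace DelPezzo

/-! Since K² = n - 9 is negative, L is positive definite; it has a basis of simple roots whose
Dynkin diagram is a tree. Three facts about O(L) carry the theorem.

The map ρ is onto (`rho_surjective`). A class with q = 1 outside the radical of the polar form
contains a root (`exists_root_red_eq`), so the images of the simple roots lift to roots. Scalar
products of distinct lifts are 0 or ±1 with prescribed parity, and on a tree the signs can be
corrected one vertex at a time.

The kernel of ρ is {±1} (`eq_one_or_eq_negOne_of_rho_eq_one`): roots congruent mod 2L agree up to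
sign, and connectedness of the diagram makes the sign constant.

Every isometry is, up to W, a symmetry of the diagram (`exists_weyl_mul_simpleBasis`). For n = 7, 8
there is no nontrivial symmetry, so W = O(L). For n = 4, 5, 6 there is at most one, and -1 is not in
W because W, unlike -1, acts trivially on the discriminant group; hence O(L) = W × {±1}, and W maps
isomorphically onto O(L₂). -/

/-! ### Positive definiteness and scalar products of roots -/

theorem mem_lattice_iff {n : ℕ} {v : Fin (n + 1) → ℤ} :
    v ∈ lattice n ↔ 3 * v 0 + ∑ i : Fin n, v i.succ = 0 := by
  have : lorentz n (K n) v = -(3 * v 0 + ∑ i : Fin n, v i.succ) := by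
    simp [lorentz_apply, K, add_comm]
  rw [lattice, LinearMap.mem_ker, this, neg_eq_zero]

/-- If v² ≤ 0, Cauchy–Schwarz applied to 3v₀ = -∑ vᵢ gives 9v₀² ≤ n ∑ vᵢ² ≤ 8v₀², which forces v₀ =
0 and then v = 0. -/
theorem form_self_pos {n : ℕ} (hn : n ≤ 8) {v : lattice n} (hv : v ≠ 0) : 0 < form n v v := by
  by_contra! h
  apply hv
  obtain ⟨v, hvL⟩ := v
  have hK := mem_lattice_iff.1 hvL
  have hf : -(v 0 * v 0) + ∑ i : Fin n, v i.succ * v i.succ ≤ 0 := h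
  have hcs := sq_sum_le_card_mul_sum_sq (s := Finset.univ) (f := fun i : Fin n => v i.succ)
  simp only [Finset.card_univ, Fintype.card_fin, sq] at hcs
  have hnn : 0 ≤ ∑ i : Fin n, v i.succ * v i.succ :=
    Finset.sum_nonneg fun i _ => mul_self_nonneg _
  have hn' : (n : ℤ) ≤ 8 := by exact_mod_cast hn
  have hs : ∑ i : Fin n, v i.succ = -(3 * v 0) := by linarith
  rw [hs] at hcs
  have h0 : v 0 = 0 := by nlinarith [mul_le_mul_of_nonneg_right hn' hnn]
  have hz : ∑ i : Fin n, v i.succ * v i.succ = 0 := by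
    rw [h0] at hf; linarith
  rw [Finset.sum_eq_zero_iff_of_nonneg fun i _ => mul_self_nonneg _] at hz
  refine Subtype.ext (funext fun i => ?_)
  refine Fin.cases h0 (fun i => ?_) i
  exact mul_self_eq_zero.1 (hz i (Finset.mem_univ i))

theorem form_self_nonneg {n : ℕ} (hn : n ≤ 8) (v : lattice n) : 0 ≤ form n v v := by
  by_cases hv : v = 0
  · simp [hv]
  · exact (form_self_pos hn hv).le

theorem eq_zero_of_form_self_nonpos {n : ℕ} (hn : n ≤ 8) {v : lattice n} (h : form n v v ≤ 0) :
    v = 0 := by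
  by_contra hv
  exact absurd (form_self_pos hn hv) h.not_gt

theorem two_le_form_self {n : ℕ} (hn : n ≤ 8) {v : lattice n} (hv : v ≠ 0) :
    2 ≤ form n v v := by
  have h1 := form_self_pos hn hv
  obtain ⟨k, hk⟩ := even_form_self n v
  omega

theorem form_sub_self {n : ℕ} (v w : lattice n) :
    form n (v - w) (v - w) = form n v v + form n w w - 2 * form n v w := by
  simp only [map_sub, LinearMap.sub_apply, form_comm n w v]
  ring

theorem form_add_self {n : ℕ} (v w : lattice n) :
    form n (v + w) (v + w) = form n v v + form n w w + 2 * form n v w := by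
  simp only [map_add, LinearMap.add_apply, form_comm n w v]
  ring

theorem abs_form_le_one_of_roots {n : ℕ} (hn : n ≤ 8) {a b : lattice n} (ha : form n a a = 2)
    (hb : form n b b = 2) (hab : a ≠ b) (hab' : a ≠ -b) : |form n a b| ≤ 1 := by
  have h1 := form_self_pos hn (sub_ne_zero.2 hab)
  have h2 := form_self_pos hn (v := a + b) (fun h => hab' (eq_neg_of_add_eq_zero_left h))
  rw [form_sub_self] at h1
  rw [form_add_self] at h2
  rw [abs_le]
  omega

/-- Roots that are congruent modulo `2L` are equal up to sign. -/
theorem eq_or_eq_neg_of_red_eq {n : ℕ} (hn : n ≤ 8) {a b : lattice n} (ha : form n a a = 2)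
    (hb : form n b b = 2) (h : red n a = red n b) : b = a ∨ b = -a := by
  obtain ⟨z, rfl⟩ := (red_eq_iff n a b).1 h
  by_contra! hne
  have hz : z ≠ 0 := by
    rintro rfl
    exact hne.1 (by simp)
  have hz' : a + z ≠ 0 := by
    intro h0
    apply hne.2
    rw [eq_neg_of_add_eq_zero_right h0]
    module
  -- Expanding (a + 2z)² = 2 gives z² + (a + z)² = 2, while nonzero vectors of L have square at
  -- least 2.
  have h1 := two_le_form_self hn hz
  have h2 := two_le_form_self hn hz'
  rw [form_add_self] at h2 hb
  simp only [map_smul, LinearMap.smul_apply, smul_eq_mul] at hb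
  omega

/-! ### Classes of L/2L that contain a root -/

/-- The vector with coordinate `a` at `E_0`, `-1` at `S` and `-c` elsewhere is a root. -/
theorem exists_root_of_card {n : ℕ} (S : Finset (Fin n)) (a c : ℤ)
    (h1 : 3 * a = S.card + c * (n - S.card))
    (h2 : -(a * a) + S.card + c * c * (n - S.card) = 2) :
    ∃ r : lattice n, form n r r = 2 ∧ (r : Fin (n + 1) → ℤ) 0 = a ∧
      ∀ i, (r : Fin (n + 1) → ℤ) i.succ = if i ∈ S then -1 else -c := by
  have key : ∀ x y : ℤ, ∑ i : Fin n, (if i ∈ S then x else y) = S.card * x + (n - S.card) * y := by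
    intro x y
    rw [Finset.sum_ite, Finset.sum_const, Finset.sum_const, Finset.filter_mem_eq_inter,
      Finset.univ_inter, Finset.filter_notMem_eq_sdiff, ← Finset.compl_eq_univ_sdiff,
      Finset.card_compl, Fintype.card_fin, nsmul_eq_mul, nsmul_eq_mul,
      Nat.cast_sub (by simpa using S.card_le_univ)]
  refine ⟨⟨Fin.cons a fun i => if i ∈ S then -1 else -c, ?_⟩, ?_, rfl, fun i => rfl⟩
  · rw [mem_lattice_iff]
    simp only [Fin.cons_zero, Fin.cons_succ, key]
    linarith
  · rw [form_apply, lorentz_apply]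
    simp only [Fin.cons_zero, Fin.cons_succ, ite_mul, mul_ite]
    simp +contextual only [if_true, if_false]
    simp only [key]
    linarith

theorem exists_root_of_card_two {n : ℕ} (S : Finset (Fin n)) (h : S.card = 2) :
    ∃ r : lattice n, form n r r = 2 ∧ (r : Fin (n + 1) → ℤ) 0 = 0 ∧
      ∀ i, Odd ((r : Fin (n + 1) → ℤ) i.succ) ↔ i ∈ S := by
  obtain ⟨x, y, hxy, rfl⟩ := Finset.card_eq_two.1 h
  refine ⟨⟨Fin.cons 0 (Pi.single x 1 - Pi.single y 1), ?_⟩, ?_, rfl, fun i => ?_⟩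
  · rw [mem_lattice_iff]
    simp
  · rw [form_apply, lorentz_apply]
    simp [mul_sub, Finset.sum_sub_distrib, Pi.single_apply, hxy, hxy.symm]
  · simp only [Fin.cons_succ, Pi.sub_apply, Pi.single_apply, Finset.mem_insert,
      Finset.mem_singleton]
    by_cases h1 : i = x
    · subst h1; simp [hxy]
    · by_cases h2 : i = y <;> simp [h1, h2, hxy.symm]

/-- L is primitive in L₀, being an orthogonal complement, so 2L₀ ∩ L = 2L. -/
theorem red_eq_of_parity {n : ℕ} {v w : lattice n}
    (h : ∀ i, Even ((w : Fin (n + 1) → ℤ) i - (v : Fin (n + 1) → ℤ) i)) :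
    red n v = red n w := by
  choose z hz using fun i => (h i).two_dvd
  have hw : (w : Fin (n + 1) → ℤ) = v + (2 : ℤ) • z := by
    funext i
    have := hz i
    simp only [Pi.add_apply, Pi.smul_apply, smul_eq_mul]
    linarith
  have hzL : z ∈ lattice n := by
    have h1 : lorentz n (K n) w = 0 := w.2
    have h2 : lorentz n (K n) v = 0 := v.2
    rw [hw, map_add, map_smul, h2, zero_add, smul_eq_mul] at h1
    show lorentz n (K n) z = 0
    omega
  exact (red_eq_iff n v w).2 ⟨⟨z, hzL⟩, Subtype.ext hw⟩

/-- A vector of `L` with odd half square is congruent modulo `2L` to a root, unless its scalar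
products with all the vectors of `L` are even. -/
theorem exists_root_red_eq {n : ℕ} (hn : n ≤ 8) {v w : lattice n} (hv : Odd (halfSq n v))
    (hw : Odd (form n v w)) : ∃ r : lattice n, form n r r = 2 ∧ red n r = red n v := by
  set f : Fin (n + 1) → ℤ := v.1 with hf
  set S : Finset (Fin n) := Finset.univ.filter fun i => Odd (f i.succ) with hS
  have memS : ∀ i, i ∈ S ↔ Odd (f i.succ) := fun i => by simp [hS]
  have hK := mem_lattice_iff.1 v.2
  have hsum : ((∑ i : Fin n, f i.succ : ℤ) : ZMod 2) = S.card := by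
    rw [Int.cast_sum, Finset.card_filter, Nat.cast_sum]
    refine Finset.sum_congr rfl fun i _ => ?_
    split_ifs with h
    · obtain ⟨k, hk⟩ := h
      rw [hk]; push_cast; rw [show (2 : ZMod 2) = 0 from rfl]; simp
    · obtain ⟨k, hk⟩ := Int.not_odd_iff_even.1 h
      rw [hk]; push_cast; rw [← two_mul, show (2 : ZMod 2) = 0 from rfl]; simp
  have hpar : Odd (f 0) ↔ Odd S.card := by
    rw [← Nat.not_even_iff_odd, ← Int.not_even_iff_odd, not_iff_not,
      ← ZMod.natCast_eq_zero_iff_even, ← hsum, ZMod.intCast_zmod_eq_zero_iff_dvd,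
      even_iff_two_dvd]
    have e : ∑ i : Fin n, f i.succ = -(3 * f 0) := by linarith
    rw [e]
    push_cast
    omega
  have hsq4 : ∀ a : ℤ, ((a * a : ℤ) : ZMod 4) = if Odd a then 1 else 0 := by
    intro a
    split_ifs with h
    · obtain ⟨k, rfl⟩ := h
      have : (2 * k + 1) * (2 * k + 1) = 4 * (k * k + k) + 1 := by ring
      rw [this]; push_cast; rw [show (4 : ZMod 4) = 0 from rfl]; simp
    · obtain ⟨k, rfl⟩ := Int.not_odd_iff_even.1 h
      have : (k + k) * (k + k) = 4 * (k * k) := by ring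
      rw [this]; push_cast; rw [show (4 : ZMod 4) = 0 from rfl]; simp
  -- Squares are 0 or 1 mod 4, so v² mod 4 depends only on the number of odd coordinates. Since v² ≡
  -- 2 mod 4, this leaves |S| ≡ 2 or 3 mod 4.
  have hsq : ((form n v v : ℤ) : ZMod 4) = ((S.card - if Odd S.card then 1 else 0 : ℤ) : ZMod 4) := by
    rw [form_apply, lorentz_apply, Int.cast_add, Int.cast_neg, Int.cast_sum]
    simp only [← hf, hsq4, hpar]
    rw [Finset.sum_boole]
    push_cast
    ring
  have hcard : S.card ≤ n := by simpa using S.card_le_univ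
  have hmod := (ZMod.intCast_eq_intCast_iff_dvd_sub _ _ _).1 hsq
  obtain ⟨m, hm⟩ := hv
  have h2 := two_mul_halfSq n v
  have fin : ∀ r : lattice n, form n r r = 2 →
      (∀ i, Odd ((r : Fin (n + 1) → ℤ) i) ↔ Odd (f i)) →
      ∃ r : lattice n, form n r r = 2 ∧ red n r = red n v := by
    refine fun r hr h => ⟨r, hr, red_eq_of_parity fun i => ?_⟩
    rw [Int.even_sub', h i]
  have use_card : ∀ a c : ℤ, 3 * a = S.card + c * (n - S.card) →
      -(a * a) + S.card + c * c * (n - S.card) = 2 → Even c → (Odd a ↔ Odd S.card) →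
      ∃ r : lattice n, form n r r = 2 ∧ red n r = red n v := by
    intro a c h1 h2 hc ha
    obtain ⟨r, hr, hr0, hri⟩ := exists_root_of_card S a c h1 h2
    refine fin r hr fun i => Fin.cases ?_ (fun i => ?_) i
    · rw [hr0, ha, hpar]
    · rw [hri, ← memS]
      split_ifs with h
      · simp [h]
      · simpa [h] using hc
  have hcases : S.card = 2 ∨ S.card = 3 ∨ S.card = 6 ∨ S.card = 7 := by
    have h8 : S.card ≤ 8 := hcard.trans hn
    generalize S.card = k at *
    interval_cases k <;> simp [Nat.odd_iff] at hmod ⊢ <;> omega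
  -- The roots with these parities are E_i - E_j, E_0 minus three E_i, 2E_0 minus six E_i, and, for
  -- n = 8, 3E_0 minus seven E_i minus twice the eighth.
  rcases hcases with h | h | h | h
  · obtain ⟨r, hr, hr0, hri⟩ := exists_root_of_card_two S h
    refine fin r hr fun i => Fin.cases ?_ (fun i => ?_) i
    · rw [hr0, hpar, h]; decide
    · rw [hri, memS]
  · exact use_card 1 0 (by rw [h]; norm_num) (by rw [h]; norm_num) (by decide) (by rw [h]; decide)
  · exact use_card 2 0 (by rw [h]; norm_num) (by rw [h]; norm_num) (by decide) (by rw [h]; decide)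
  · have : n = 7 ∨ n = 8 := by omega
    rcases this with rfl | rfl
    -- Here v ≡ K mod 2L₀; as K is orthogonal to L, v has even product with every vector of L,
    -- contrary to the choice of w.
    · exfalso
      have hall : ∀ i : Fin 7, Odd (f i.succ) := by
        intro i
        rw [← memS, Finset.eq_univ_of_card S (by simpa using h)]
        exact Finset.mem_univ i
      have h0 : Odd (f 0) := by rw [hpar, h]; decide
      have hKw := mem_lattice_iff.1 w.2
      have e : form 7 v w + (3 * (w : Fin 8 → ℤ) 0 + ∑ i : Fin 7, (w : Fin 8 → ℤ) i.succ)
          = (3 - f 0) * (w : Fin 8 → ℤ) 0 + ∑ i : Fin 7, (f i.succ + 1) * (w : Fin 8 → ℤ) i.succ := by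
        rw [form_apply, lorentz_apply]
        simp only [add_mul, one_mul, Finset.sum_add_distrib, ← hf]
        ring
      rw [hKw, add_zero] at e
      rw [e, ← Int.not_even_iff_odd] at hw
      apply hw
      refine Even.add (Even.mul_right ?_ _) (Finset.even_sum _ fun i _ => Even.mul_right ?_ _)
      · exact Odd.sub_odd (by decide) h0
      · exact (hall i).add_odd odd_one
    · exact use_card 3 2 (by rw [h]; norm_num) (by rw [h]; norm_num) (by decide)
        (by rw [h]; decide)


/-! ### The simple roots and their diagram -/

/-- The coordinates of `E_{i+1} - E_{i+2}` for `i + 1 < n`, and of `E_0 - E_1 - E_2 - E_3` for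
`i + 1 = n`. -/
def simpleVec (n : ℕ) (i : Fin n) : Fin (n + 1) → ℤ := fun k =>
  if i.val + 1 = n then (if k.val = 0 then 1 else if k.val ≤ 3 then -1 else 0)
  else (if k.val = i.val + 1 then 1 else if k.val = i.val + 2 then -1 else 0)

/-- The parent of a vertex in the Dynkin diagram, a tree rooted at the vertex `0`. -/
def parent (n j : ℕ) : ℕ := if j + 1 = n then 2 else j - 1

/-- The coordinates of a vector of `L` with respect to the simple roots. -/
def simpleCoord (n : ℕ) : lattice n →ₗ[ℤ] (Fin n → ℤ) where
  -- Only the last simple root involves E_0, so its coefficient is v₀. Subtracting that multiple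
  -- adds v₀ to the coordinates at E_1, E_2, E_3; the other coefficients are the partial sums of
  -- what remains.
  toFun v i := if i.val + 1 = n then v.1 0
    else ∑ k : Fin (n + 1), if k.val = 0 then (min (i.val + 1) 3 : ℕ) * v.1 k
      else if k.val ≤ i.val + 1 then v.1 k else 0
  map_add' v w := by
    funext i
    simp only [Submodule.coe_add, Pi.add_apply]
    split_ifs with h
    · rfl
    · rw [← Finset.sum_add_distrib]
      refine Finset.sum_congr rfl fun k _ => ?_
      split_ifs <;> ring
  map_smul' c v := by
    funext i
    simp only [Submodule.coe_smul, Pi.smul_apply, smul_eq_mul, RingHom.id_apply]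
    split_ifs with h
    · rfl
    · rw [Finset.mul_sum]
      refine Finset.sum_congr rfl fun k _ => ?_
      split_ifs <;> ring

theorem simpleVec_mem {n : ℕ} (h4 : 4 ≤ n) (hn : n ≤ 8) (i : Fin n) :
    simpleVec n i ∈ lattice n := by
  rw [mem_lattice_iff]
  interval_cases n <;> revert i <;> decide +kernel

theorem simpleCoord_simpleVec {n : ℕ} (h4 : 4 ≤ n) (hn : n ≤ 8) (i : Fin n) :
    simpleCoord n ⟨simpleVec n i, simpleVec_mem h4 hn i⟩ = Pi.single i 1 := by
  funext j
  change (if j.val + 1 = n then simpleVec n i 0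
    else ∑ k : Fin (n + 1), if k.val = 0 then ((min (j.val + 1) 3 : ℕ) : ℤ) * simpleVec n i k
      else if k.val ≤ j.val + 1 then simpleVec n i k else 0) = (Pi.single i 1 : Fin n → ℤ) j
  rw [Pi.single_apply]
  interval_cases n <;> revert i j <;> decide +kernel

theorem simpleCoord_injective {n : ℕ} (h4 : 4 ≤ n) (hn : n ≤ 8) :
    Function.Injective (simpleCoord n) := by
  rw [injective_iff_map_eq_zero]
  rintro ⟨v, hv⟩ h
  rw [mem_lattice_iff] at hv
  have h' := fun i => congrFun h i
  have hlast := h' ⟨n - 1, by omega⟩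
  simp only [simpleCoord, LinearMap.coe_mk, AddHom.coe_mk, Pi.zero_apply] at h' hlast
  rw [if_pos (by omega)] at hlast
  refine Subtype.ext (funext fun i => ?_)
  change v i = 0
  interval_cases n <;> simp [Fin.forall_fin_succ, Fin.sum_univ_succ] at h' hv hlast <;>
    fin_cases i <;> simp <;> omega

/-- The simple roots, as a basis of `L`. -/
noncomputable def simpleBasis {n : ℕ} (h4 : 4 ≤ n) (hn : n ≤ 8) : Module.Basis (Fin n) ℤ (lattice n) :=
  .ofEquivFun (LinearEquiv.ofBijective (simpleCoord n) ⟨simpleCoord_injective h4 hn, by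
    rw [← LinearMap.range_eq_top, ← top_le_iff, ← (Pi.basisFun ℤ (Fin n)).span_eq,
      Submodule.span_le]
    rintro _ ⟨i, rfl⟩
    exact ⟨_, (simpleCoord_simpleVec h4 hn i).trans (Pi.basisFun_apply ℤ (Fin n) i).symm⟩⟩)

theorem simpleBasis_coe {n : ℕ} (h4 : 4 ≤ n) (hn : n ≤ 8) (i : Fin n) :
    (simpleBasis h4 hn i : Fin (n + 1) → ℤ) = simpleVec n i := by
  have : simpleBasis h4 hn i = ⟨simpleVec n i, simpleVec_mem h4 hn i⟩ := by
    apply (simpleBasis h4 hn).equivFun.injective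
    refine Eq.trans ?_ (simpleCoord_simpleVec h4 hn i).symm
    funext j
    rw [Module.Basis.equivFun_self, Pi.single_apply]
    simp only [eq_comm]
  rw [this]

theorem form_simpleBasis {n : ℕ} (h4 : 4 ≤ n) (hn : n ≤ 8) (i j : Fin n) :
    form n (simpleBasis h4 hn i) (simpleBasis h4 hn j) =
      if i = j then 2
      else if (i < j ∧ i.val = parent n j) ∨ (j < i ∧ j.val = parent n i) then -1 else 0 := by
  rw [form_apply, simpleBasis_coe, simpleBasis_coe, lorentz_apply]
  interval_cases n <;> revert i j <;> decide +kernel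

theorem parent_lt {n j : ℕ} (h4 : 4 ≤ n) (hj : j ≠ 0) : parent n j < j := by
  unfold parent; split_ifs <;> omega

/-- A vector of `L` that has the same positive scalar product with all the simple roots. -/
theorem exists_weylVector {n : ℕ} (h4 : 4 ≤ n) (hn : n ≤ 8) :
    ∃ (h : lattice n) (c : ℤ), 0 < c ∧ ∀ i, form n h (simpleBasis h4 hn i) = c := by
  -- The vector p has product 1 with every simple root, and t = K · p. As K² = n - 9, the
  -- combination (9 - n)p + tK is orthogonal to K, and its products with the simple roots are 9 - n.
  let p : Fin (n + 1) → ℤ := fun k => if k.val = 0 then 5 else -(k.val : ℤ)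
  let t : ℤ := -15 + ∑ i : Fin n, ((i.val : ℤ) + 1)
  have hL : (fun k => (9 - n) * p k + t * K n k) ∈ lattice n := by
    rw [mem_lattice_iff]
    simp only [p, t, K]
    interval_cases n <;> decide +kernel
  refine ⟨⟨_, hL⟩, 9 - n, by omega, fun i => ?_⟩
  rw [form_apply, simpleBasis_coe, lorentz_apply]
  simp only [p, t, K]
  interval_cases n <;> revert i <;> decide +kernel


/-! ### Positive roots, the Weyl vector and isometries modulo W -/

section
variable {n : ℕ} (h4 : 4 ≤ n) (hn : n ≤ 8)

theorem form_simpleBasis_self (i : Fin n) :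
    form n (simpleBasis h4 hn i) (simpleBasis h4 hn i) = 2 := by
  rw [form_simpleBasis, if_pos rfl]

theorem form_simpleBasis_nonpos {i j : Fin n} (hij : i ≠ j) :
    form n (simpleBasis h4 hn i) (simpleBasis h4 hn j) ≤ 0 := by
  rw [form_simpleBasis, if_neg hij]
  split_ifs <;> norm_num

theorem form_simpleBasis_of_lt {i j : Fin n} (hij : i < j) :
    form n (simpleBasis h4 hn i) (simpleBasis h4 hn j) = if i.val = parent n j then -1 else 0 := by
  rw [form_simpleBasis, if_neg hij.ne]
  simp [hij, hij.not_gt]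

theorem form_sum_right (v : lattice n) (p : Fin n → ℤ) (b : Fin n → lattice n) :
    form n v (∑ i, p i • b i) = ∑ i, p i * form n v (b i) := by
  simp [map_sum]

theorem form_sum_left (v : lattice n) (p : Fin n → ℤ) (b : Fin n → lattice n) :
    form n (∑ i, p i • b i) v = ∑ i, p i * form n (b i) v := by
  rw [form_comm, form_sum_right]
  simp only [form_comm n v]

/-- Every vector is a difference of two nonnegative combinations of simple roots with nonpositive
scalar product. -/
theorem exists_eq_sub_of_nonneg (v : lattice n) :
    ∃ p m : Fin n → ℤ, (∀ i, 0 ≤ p i) ∧ (∀ i, 0 ≤ m i) ∧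
      v = ∑ i, p i • simpleBasis h4 hn i - ∑ i, m i • simpleBasis h4 hn i ∧
      form n (∑ i, p i • simpleBasis h4 hn i) (∑ i, m i • simpleBasis h4 hn i) ≤ 0 := by
  set b := simpleBasis h4 hn with hb
  -- The positive and negative parts have disjoint supports, so only products of distinct simple
  -- roots contribute.
  refine ⟨fun i => max (b.repr v i) 0, fun i => max (-b.repr v i) 0, fun i => le_max_right _ _,
    fun i => le_max_right _ _, ?_, ?_⟩
  · rw [← Finset.sum_sub_distrib]
    conv_lhs => rw [← b.sum_repr v]
    refine Finset.sum_congr rfl fun i _ => ?_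
    rw [← sub_smul]
    congr 1
    rcases le_total (b.repr v i) 0 with h | h <;> simp [h]
  · rw [form_sum_left]
    refine Finset.sum_nonpos fun i _ => ?_
    rw [form_sum_right, Finset.mul_sum]
    refine Finset.sum_nonpos fun j _ => ?_
    by_cases hij : i = j
    · subst hij
      rcases le_total (b.repr v i) 0 with h | h <;> simp [h]
    · exact mul_nonpos_of_nonneg_of_nonpos (le_max_right _ _)
        (mul_nonpos_of_nonneg_of_nonpos (le_max_right _ _) (form_simpleBasis_nonpos h4 hn hij))

/-- A dominant vector is a nonnegative combination of the simple roots. -/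
theorem exists_nonneg_of_dominant {v : lattice n}
    (hv : ∀ i, 0 ≤ form n v (simpleBasis h4 hn i)) :
    ∃ p : Fin n → ℤ, (∀ i, 0 ≤ p i) ∧ v = ∑ i, p i • simpleBasis h4 hn i := by
  obtain ⟨p, m, hp, hm, he, hpm⟩ := exists_eq_sub_of_nonneg h4 hn v
  refine ⟨p, hp, ?_⟩
  -- Writing P and M for the two combinations, 0 ≤ v · M = P · M - M² ≤ -M², so M = 0.
  have h1 : 0 ≤ form n v (∑ i, m i • simpleBasis h4 hn i) := by
    rw [form_sum_right]
    exact Finset.sum_nonneg fun i _ => mul_nonneg (hm i) (hv i)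
  rw [he, map_sub, LinearMap.sub_apply] at h1
  have h2 := eq_zero_of_form_self_nonpos hn
    (v := ∑ i, m i • simpleBasis h4 hn i) (by linarith)
  rw [he, h2, sub_zero]

theorem form_nonneg_of_dominant {v w : lattice n}
    (hv : ∀ i, 0 ≤ form n v (simpleBasis h4 hn i))
    (hw : ∀ i, 0 ≤ form n w (simpleBasis h4 hn i)) : 0 ≤ form n v w := by
  obtain ⟨p, hp, rfl⟩ := exists_nonneg_of_dominant h4 hn hw
  rw [form_sum_right]
  exact Finset.sum_nonneg fun i _ => mul_nonneg (hp i) (hv i)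

/-- With a = P - M and P · M ≤ 0, one gets P² + M² ≤ 2; since nonzero squares are at least 2, one of
P, M vanishes. -/
theorem exists_nonneg_of_root {a : lattice n} (ha : form n a a = 2) :
    ∃ p : Fin n → ℤ, (∀ i, 0 ≤ p i) ∧ (a = ∑ i, p i • simpleBasis h4 hn i ∨
      a = -∑ i, p i • simpleBasis h4 hn i) := by
  obtain ⟨p, m, hp, hm, he, hpm⟩ := exists_eq_sub_of_nonneg h4 hn a
  set x := ∑ i, p i • simpleBasis h4 hn i
  set y := ∑ i, m i • simpleBasis h4 hn i
  rw [he, form_sub_self] at ha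
  by_cases hx : x = 0
  · exact ⟨m, hm, Or.inr (by rw [he, hx, zero_sub])⟩
  · refine ⟨p, hp, Or.inl ?_⟩
    have h1 := two_le_form_self hn hx
    rw [he, eq_zero_of_form_self_nonpos hn (v := y) (by linarith), sub_zero]

variable {h : lattice n} {c : ℤ} (hc : 0 < c) (hh : ∀ i, form n h (simpleBasis h4 hn i) = c)
include hc hh

theorem le_form_weylVector {p : Fin n → ℤ} (hp : ∀ i, 0 ≤ p i)
    (hne : ∑ i, p i • simpleBasis h4 hn i ≠ 0) :
    c ≤ form n h (∑ i, p i • simpleBasis h4 hn i) := by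
  rw [form_sum_right]
  simp only [hh]
  rw [← Finset.sum_mul]
  refine le_mul_of_one_le_left hc.le ?_
  have h0 : ∑ i, p i ≠ 0 := by
    rw [Ne, Finset.sum_eq_zero_iff_of_nonneg fun i _ => hp i]
    intro h0
    exact hne (Finset.sum_eq_zero fun i hi => by rw [h0 i hi, zero_smul])
  have := Finset.sum_nonneg fun i (_ : i ∈ Finset.univ) => hp i
  omega

theorem abs_form_weylVector_of_root {a : lattice n} (ha : form n a a = 2) :
    c ≤ |form n h a| := by
  obtain ⟨p, hp, h1 | h1⟩ := exists_nonneg_of_root h4 hn ha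
  · have := le_form_weylVector h4 hn hc hh hp (by rw [← h1]; rintro rfl; simp at ha)
    rw [← h1] at this
    exact this.trans (le_abs_self _)
  · have := le_form_weylVector h4 hn hc hh hp (by
      rw [← neg_ne_zero, ← h1]; rintro rfl; simp at ha)
    rw [h1, map_neg, abs_neg]
    exact this.trans (le_abs_self _)

/-- Every isometry can be composed with an element of the Weyl group so as to fix `h`. -/
theorem exists_weyl_mul_fix (u : orthL n) : ∃ w ∈ weyl n, (w * u).1 h = h := by
  -- Choose w in W maximising (wu)(h) · h, which is at most h² because ((wu)(h) - h)² ≥ 0.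
  obtain ⟨m, ⟨w, hw, rfl⟩, hmax⟩ := Int.exists_greatest_of_bdd
    (P := fun z => ∃ w ∈ weyl n, form n ((w * u).1 h) h = z)
    ⟨form n h h, by
      rintro _ ⟨w, -, rfl⟩
      have h1 := form_self_nonneg hn ((w * u).1 h - h)
      rw [form_sub_self, (w * u).2 h h] at h1
      linarith⟩ ⟨_, 1, one_mem _, rfl⟩
  refine ⟨w, hw, ?_⟩
  set g := w * u with hg
  have hdom : ∀ i, c ≤ form n (g.1 h) (simpleBasis h4 hn i) := by
    intro i
    set a := simpleBasis h4 hn i with ha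
    have haa : form n a a = 2 := form_simpleBasis_self h4 hn i
    have h1 := hmax _ ⟨rootReflection n ⟨a, haa⟩ * w,
      mul_mem (Subgroup.subset_closure ⟨_, rfl⟩) hw, rfl⟩
    rw [mul_assoc, ← hg] at h1
    change form n ((rootReflection n ⟨a, haa⟩).1 (g.1 h)) h ≤ _ at h1
    rw [rootReflection_apply] at h1
    simp only [map_sub, map_smul, LinearMap.sub_apply, LinearMap.smul_apply, smul_eq_mul] at h1
    rw [form_comm n a h, ha, hh, ← ha] at h1
    -- Maximality against the reflection in a makes a · g(h) nonnegative. It equals h · g⁻¹(a) with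
    -- g⁻¹(a) a root, so it is at least c; hence g(h) - h is dominant.
    have h2 : 0 ≤ form n a (g.1 h) := by nlinarith
    have h3 : form n (g.1 h) a = form n h (g⁻¹.1 a) := by
      have := g⁻¹.2 (g.1 h) a
      rw [← this]
      congr 2
      exact g.1.symm_apply_apply h
    have h5 := abs_form_weylVector_of_root h4 hn hc hh (a := g⁻¹.1 a) (by rw [g⁻¹.2, haa])
    rw [← h3, form_comm, abs_of_nonneg h2, form_comm] at h5
    exact h5
  have h1 : 0 ≤ form n h (g.1 h - h) := by
    refine form_nonneg_of_dominant h4 hn (fun i => by rw [hh]; exact hc.le) fun i => ?_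
    rw [map_sub, LinearMap.sub_apply, hh]
    linarith [hdom i]
  rw [← sub_eq_zero]
  apply eq_zero_of_form_self_nonpos hn
  rw [form_sub_self, g.2, form_comm n (g.1 h)]
  rw [map_sub] at h1
  linarith

/-- If a differs from every simple root, a positive product with some aᵢ would make a - aᵢ a root
orthogonal to h, which is impossible. So -a is dominant and h · (-a) ≥ 0, contradicting c > 0. -/
theorem eq_simpleBasis_of_root {a : lattice n} (ha : form n a a = 2) (hac : form n h a = c) :
    ∃ i, a = simpleBasis h4 hn i := by
  by_contra! hne
  have h1 : ∀ i, form n a (simpleBasis h4 hn i) ≤ 0 := by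
    intro i
    by_contra! hpos
    have h2 := abs_form_weylVector_of_root h4 hn hc hh (a := a - simpleBasis h4 hn i) (by
      have h3 := form_self_pos hn (sub_ne_zero.2 (hne i))
      rw [form_sub_self, ha, form_simpleBasis_self] at h3 ⊢
      omega)
    rw [map_sub, hac, hh, sub_self, abs_zero] at h2
    omega
  have h2 := form_nonneg_of_dominant h4 hn (v := h) (w := -a) (fun i => by rw [hh]; exact hc.le)
    (fun i => by rw [map_neg, LinearMap.neg_apply]; linarith [h1 i])
  rw [map_neg, hac] at h2
  omega

theorem exists_simpleBasis_of_fix {g : orthL n} (hg : g.1 h = h) :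
    ∃ σ : Fin n → Fin n, ∀ i, g.1 (simpleBasis h4 hn i) = simpleBasis h4 hn (σ i) := by
  refine Classical.skolem.1 fun i => eq_simpleBasis_of_root h4 hn hc hh ?_ ?_
  · rw [g.2, form_simpleBasis_self]
  · have h1 := g.2 h (simpleBasis h4 hn i)
    rwa [hg, hh] at h1

end

theorem orthL_ext {n : ℕ} (h4 : 4 ≤ n) (hn : n ≤ 8) {u u' : orthL n}
    (h : ∀ i, u.1 (simpleBasis h4 hn i) = u'.1 (simpleBasis h4 hn i)) : u = u' :=
  Subtype.ext ((simpleBasis h4 hn).ext' h)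

/-- Every isometry is the product of an element of the Weyl group and of a permutation of the
simple roots. -/
theorem exists_weyl_mul_simpleBasis {n : ℕ} (h4 : 4 ≤ n) (hn : n ≤ 8) (u : orthL n) :
    ∃ w ∈ weyl n, ∃ σ : Fin n → Fin n,
      ∀ i, (w * u).1 (simpleBasis h4 hn i) = simpleBasis h4 hn (σ i) := by
  obtain ⟨h, c, hc, hh⟩ := exists_weylVector h4 hn
  obtain ⟨w, hw, hg⟩ := exists_weyl_mul_fix h4 hn hc hh u
  exact ⟨w, hw, exists_simpleBasis_of_fix h4 hn hc hh hg⟩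


/-! ### Surjectivity and kernel of ρ -/

theorem polar_qFun_map {n : ℕ} (g : orthL2 n) (x y : latticeMod2 n) :
    QuadraticMap.polar (qFun n) (g.1 x) (g.1 y) = QuadraticMap.polar (qFun n) x y := by
  have h : ∀ x, qFun n (g.1 x) = qFun n x := g.2
  have e : qFun n (g.1 x + g.1 y) = qFun n (x + y) :=
    (congrArg (qFun n) (g.1.map_add x y).symm).trans (h _)
  simp only [QuadraticMap.polar, h, e]

theorem two_dvd_form_sub {n : ℕ} (g : orthL2 n) {a b v w : lattice n}
    (hv : red n v = g.1 (red n a)) (hw : red n w = g.1 (red n b)) :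
    (2 : ℤ) ∣ form n v w - form n a b := by
  refine (ZMod.intCast_eq_intCast_iff_dvd_sub _ _ 2).1 ?_
  rw [← polar_qFun_red n a b, ← polar_qFun_red n v w, hv, hw, polar_qFun_map]

theorem two_dvd_halfSq_sub {n : ℕ} (g : orthL2 n) {a v : lattice n}
    (hv : red n v = g.1 (red n a)) : (2 : ℤ) ∣ halfSq n v - halfSq n a := by
  refine (ZMod.intCast_eq_intCast_iff_dvd_sub _ _ 2).1 ?_
  rw [← q_red n a, ← q_red n v, hv]
  exact (g.2 _).symm

theorem red_neg {n : ℕ} (v : lattice n) : red n (-v) = red n v :=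
  ((red_eq_iff n _ _).2 ⟨-v, by module⟩).symm

section
variable {n : ℕ} (h4 : 4 ≤ n) (hn : n ≤ 8)

theorem form_simpleBasis_parent {i j : Fin n} (hj : j.val ≠ 0) (hi : i.val = parent n j) :
    form n (simpleBasis h4 hn i) (simpleBasis h4 hn j) = -1 := by
  rw [form_simpleBasis_of_lt, if_pos hi]
  rw [Fin.lt_def, hi]
  exact parent_lt h4 hj

/-- This keeps the class of a simple root out of the radical of the polar form, as
`exists_root_red_eq` requires. -/
theorem exists_form_simpleBasis_eq_neg_one (i : Fin n) :
    ∃ j, form n (simpleBasis h4 hn i) (simpleBasis h4 hn j) = -1 := by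
  by_cases hi : i.val = 0
  · refine ⟨⟨1, by omega⟩, form_simpleBasis_parent h4 hn one_ne_zero ?_⟩
    rw [hi, parent, if_neg (by simp; omega)]
    rfl
  · refine ⟨⟨parent n i, (parent_lt h4 hi).trans i.2⟩, ?_⟩
    rw [form_comm]
    exact form_simpleBasis_parent h4 hn hi rfl

theorem red_simpleBasis_injective : Function.Injective fun i => red n (simpleBasis h4 hn i) := by
  intro i j hij
  by_contra hne
  have h0 := form_simpleBasis h4 hn i j
  rw [if_neg hne] at h0
  rcases eq_or_eq_neg_of_red_eq hn (form_simpleBasis_self h4 hn i) (form_simpleBasis_self h4 hn j)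
    hij with h | h
  all_goals
    rw [h] at h0
    simp only [map_neg, form_simpleBasis_self] at h0
    split_ifs at h0; all_goals omega

/-- The image of a simple root under an isometry of `L / 2L` lifts to a root. -/
theorem exists_root_lift (g : orthL2 n) (i : Fin n) :
    ∃ r : lattice n, form n r r = 2 ∧ red n r = g.1 (red n (simpleBasis h4 hn i)) := by
  obtain ⟨j, hj⟩ := exists_form_simpleBasis_eq_neg_one h4 hn i
  obtain ⟨v, hv⟩ := red_surjective n (g.1 (red n (simpleBasis h4 hn i)))
  obtain ⟨w, hw⟩ := red_surjective n (g.1 (red n (simpleBasis h4 hn j)))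
  have h1 := two_dvd_form_sub g hv hw
  have h2 := two_dvd_halfSq_sub g hv
  have h3 := two_mul_halfSq n (simpleBasis h4 hn i)
  rw [form_simpleBasis_self] at h3
  obtain ⟨r, hr, hrv⟩ := exists_root_red_eq hn (v := v) (w := w)
    (by rw [Int.odd_iff]; omega) (by rw [Int.odd_iff]; omega)
  exact ⟨r, hr, hrv.trans hv⟩

/-- The signs of the lifts can be chosen so that they have the scalar products of the simple
roots. -/
theorem exists_simple_lift (g : orthL2 n) (k : ℕ) (hk : k ≤ n) :
    ∃ β : Fin n → lattice n,
      (∀ i, i.val < k → form n (β i) (β i) = 2 ∧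
        red n (β i) = g.1 (red n (simpleBasis h4 hn i))) ∧
      ∀ i j, i < j → j.val < k →
        form n (β i) (β j) = form n (simpleBasis h4 hn i) (simpleBasis h4 hn j) := by
  induction k with
  | zero => exact ⟨0, by simp, by simp⟩
  | succ k ih =>
    obtain ⟨β, hβ, hβ'⟩ := ih (by omega)
    let K : Fin n := ⟨k, hk⟩
    obtain ⟨r, hr, hrg⟩ := exists_root_lift h4 hn g K
    have key : ∀ i, i < K → |form n (β i) r| ≤ 1 ∧
        (2 : ℤ) ∣ form n (β i) r - form n (simpleBasis h4 hn i) (simpleBasis h4 hn K) := by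
      intro i hi
      obtain ⟨h1, h2⟩ := hβ i hi
      have hne : red n (β i) ≠ red n r := by
        rw [h2, hrg]
        exact fun h => hi.ne (red_simpleBasis_injective h4 hn (g.1.injective h))
      exact ⟨abs_form_le_one_of_roots hn h1 hr (fun h => hne (by rw [h]))
        (fun h => hne (by rw [h, red_neg])), two_dvd_form_sub g h2 hrg⟩
    -- Among the earlier vertices only the parent is joined to k. Its product with r is odd, hence
    -- ±1, and fixes the sign; the others are even of absolute value at most 1, hence 0 for either
    -- sign.
    obtain ⟨s, hs, hsr⟩ : ∃ s : lattice n, (s = r ∨ s = -r) ∧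
        ∀ i, i < K → form n (β i) s = form n (simpleBasis h4 hn i) (simpleBasis h4 hn K) := by
      by_cases h0 : k = 0
      · exact ⟨r, Or.inl rfl, fun i hi => absurd hi (by simp [Fin.lt_def, K, h0])⟩
      · let p : Fin n := ⟨parent n k, (parent_lt h4 h0).trans hk⟩
        have hpK : p < K := parent_lt h4 h0
        have hp := form_simpleBasis_parent h4 hn (i := p) (j := K) h0 rfl
        have hother : ∀ i, i < K → i ≠ p →
            form n (simpleBasis h4 hn i) (simpleBasis h4 hn K) = 0 ∧ form n (β i) r = 0 := by
          intro i hi hip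
          have h1 := form_simpleBasis_of_lt h4 hn hi
          rw [if_neg (fun h => hip (Fin.ext h))] at h1
          obtain ⟨h2, h3⟩ := key i hi
          rw [abs_le] at h2
          omega
        obtain ⟨h2, h3⟩ := key p hpK
        rw [abs_le] at h2
        have h5 : form n (β p) r = -1 ∨ form n (β p) r = 1 := by omega
        rcases h5 with h5 | h5
        · refine ⟨r, Or.inl rfl, fun i hi => ?_⟩
          by_cases hip : i = p
          · rw [hip, hp, h5]
          · obtain ⟨h6, h7⟩ := hother i hi hip
            rw [h6, h7]
        · refine ⟨-r, Or.inr rfl, fun i hi => ?_⟩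
          rw [map_neg]
          by_cases hip : i = p
          · rw [hip, hp, h5]
          · obtain ⟨h6, h7⟩ := hother i hi hip
            rw [h6, h7, neg_zero]
    refine ⟨Function.update β K s, fun i hi => ?_, fun i j hij hj => ?_⟩
    · by_cases hiK : i = K
      · subst hiK
        rw [Function.update_self, ← hrg]
        rcases hs with rfl | rfl
        · exact ⟨hr, rfl⟩
        · exact ⟨by simpa using hr, red_neg r⟩
      · rw [Function.update_of_ne hiK]
        exact hβ i (lt_of_le_of_ne (Nat.lt_succ_iff.1 hi) fun h => hiK (Fin.ext h))
    · have hjK' : j ≤ K := Nat.lt_succ_iff.1 hj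
      rw [Function.update_of_ne (hij.trans_le hjK').ne]
      by_cases hjK : j = K
      · subst hjK
        rw [Function.update_self, hsr i hij]
      · rw [Function.update_of_ne hjK]
        exact hβ' i j hij (lt_of_le_of_ne hjK' fun h => hjK (Fin.ext h))

include hn in
theorem nondegenerate_form : (form n).Nondegenerate := by
  refine ⟨fun v hv => ?_, fun v hv => ?_⟩
  all_goals exact eq_zero_of_form_self_nonpos hn (hv v).le

/-- Vectors with the scalar products of the simple roots are their images under an isometry. -/
theorem exists_orthL_apply_simpleBasis (β : Fin n → lattice n)
    (hβ : ∀ i j, form n (β i) (β j) = form n (simpleBasis h4 hn i) (simpleBasis h4 hn j)) :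
    ∃ u : orthL n, ∀ i, u.1 (simpleBasis h4 hn i) = β i := by
  set b := simpleBasis h4 hn with hb
  let f : lattice n →ₗ[ℤ] lattice n := b.constr ℤ β
  have hf : ∀ i, f (b i) = β i := fun i => b.constr_basis ℤ β i
  have hcomp : (form n).comp f f = form n := by
    refine LinearMap.ext_basis b b fun i j => ?_
    rw [LinearMap.BilinForm.comp_apply, hf, hf, hβ]
  -- Comparing Gram determinants gives (det f)² = 1, since the form is nondegenerate.
  have hdet : IsUnit (LinearMap.toMatrix b b f).det := by
    have h1 := congrArg Matrix.det (LinearMap.BilinForm.toMatrix_comp b b (form n) f f)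
    rw [hcomp, Matrix.det_mul, Matrix.det_mul, Matrix.det_transpose] at h1
    have h2 := (LinearMap.BilinForm.nondegenerate_iff_det_ne_zero b).1 (nondegenerate_form hn)
    refine IsUnit.of_mul_eq_one (LinearMap.toMatrix b b f).det (mul_right_cancel₀ h2 ?_)
    linarith
  refine ⟨⟨LinearEquiv.ofIsUnitDet hdet, fun v w => ?_⟩, hf⟩
  exact LinearMap.congr_fun₂ hcomp v w

include h4 hn in
theorem rho_surjective : Function.Surjective (rho n) := by
  intro g
  obtain ⟨β, hβ, hβ'⟩ := exists_simple_lift h4 hn g n le_rfl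
  obtain ⟨u, hu⟩ := exists_orthL_apply_simpleBasis h4 hn β fun i j => by
    rcases lt_trichotomy i j with h | rfl | h
    · exact hβ' i j h j.2
    · rw [(hβ i i.2).1, form_simpleBasis_self]
    · rw [form_comm, hβ' j i h i.2, form_comm]
  refine ⟨u, Subtype.ext (LinearEquiv.ext fun x => ?_)⟩
  obtain ⟨v, rfl⟩ := red_surjective n x
  rw [rho_red, ← (simpleBasis h4 hn).sum_repr v]
  simp only [map_sum, map_zsmul, hu, (hβ _ (Fin.isLt _)).2]

include h4 hn in
-- Each simple root goes to plus or minus itself. Joined vertices have nonzero product, so the sign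
-- passes from parent to child and is that of the root of the tree.
theorem eq_one_or_eq_negOne_of_rho_eq_one {u : orthL n} (hu : rho n u = 1) :
    u = 1 ∨ u = negOne n := by
  set b := simpleBasis h4 hn with hb
  have key : ∀ i, u.1 (b i) = b i ∨ u.1 (b i) = -b i := by
    intro i
    refine eq_or_eq_neg_of_red_eq hn (form_simpleBasis_self h4 hn i)
      (by rw [u.2, form_simpleBasis_self]) ?_
    rw [← rho_red, hu]
    rfl
  have prop : ∀ ε : ℤ, (ε = 1 ∨ ε = -1) → u.1 (b ⟨0, by omega⟩) = ε • b ⟨0, by omega⟩ →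
      ∀ k, ∀ hk : k < n, u.1 (b ⟨k, hk⟩) = ε • b ⟨k, hk⟩ := by
    intro ε hε h0 k
    induction k using Nat.strong_induction_on with
    | _ k ih =>
      intro hk
      by_cases hk0 : k = 0
      · subst hk0; exact h0
      have hp := parent_lt h4 hk0
      have h1 := ih _ hp (hp.trans hk)
      have h2 : form n (b ⟨parent n k, hp.trans hk⟩) (b ⟨k, hk⟩) = -1 :=
        form_simpleBasis_parent h4 hn hk0 rfl
      have h3 := u.2 (b ⟨parent n k, hp.trans hk⟩) (b ⟨k, hk⟩)
      rw [h1, map_smul, LinearMap.smul_apply, h2, smul_eq_mul] at h3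
      rcases key ⟨k, hk⟩ with h | h <;> rw [h] at h3 ⊢ <;>
        simp only [map_neg, h2] at h3 <;> rcases hε with rfl | rfl <;> simp at h3 ⊢
  rcases key ⟨0, by omega⟩ with h | h
  · left
    refine orthL_ext h4 hn fun i => ?_
    exact (prop 1 (Or.inl rfl) (by rw [h, one_smul]) i i.2).trans (one_smul _ _)
  · right
    refine orthL_ext h4 hn fun i => ?_
    exact (prop (-1) (Or.inr rfl) (by rw [h, neg_one_smul]) i i.2).trans (neg_one_smul _ _)

end

theorem rho_negOne (n : ℕ) : rho n (negOne n) = 1 := by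
  refine Subtype.ext (LinearEquiv.ext fun x => ?_)
  obtain ⟨v, rfl⟩ := red_surjective n x
  rw [rho_red]
  exact red_neg v

theorem rho_eq_one_iff {n : ℕ} (h4 : 4 ≤ n) (hn : n ≤ 8) (u : orthL n) :
    rho n u = 1 ↔ u ∈ pmOne n := by
  refine ⟨eq_one_or_eq_negOne_of_rho_eq_one h4 hn, ?_⟩
  rintro (rfl | rfl)
  · exact map_one _
  · exact rho_negOne n


/-! ### Symmetries of the Dynkin diagrams -/

/-- The scalar products of the simple roots. -/
def gram (n : ℕ) (i j : Fin n) : ℤ :=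
  if i = j then 2
  else if (i < j ∧ i.val = parent n j) ∨ (j < i ∧ j.val = parent n i) then -1 else 0

/-- The hypotheses trace a path; a zero product excludes turning back, since a vertex has product 2
with itself. Interleaving them with the quantifiers prunes the finite search. -/
theorem diagram_four : ∀ a b : Fin 4, gram 4 a b = -1 →
    ∀ c, gram 4 b c = -1 → gram 4 a c = 0 → ∀ d, gram 4 c d = -1 → gram 4 b d = 0 →
    (a = 0 ∧ b = 1 ∧ c = 2 ∧ d = 3) ∨ (a = 3 ∧ b = 2 ∧ c = 1 ∧ d = 0) := by
  decide +kernel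

theorem diagram_five : ∀ a b : Fin 5, gram 5 a b = -1 →
    ∀ c, gram 5 b c = -1 → gram 5 a c = 0 → ∀ d, gram 5 c d = -1 → gram 5 b d = 0 →
    ∀ e, gram 5 c e = -1 → gram 5 b e = 0 → gram 5 d e = 0 →
    (a = 0 ∧ b = 1 ∧ c = 2 ∧ d = 3 ∧ e = 4) ∨ (a = 0 ∧ b = 1 ∧ c = 2 ∧ d = 4 ∧ e = 3) := by
  decide +kernel

set_option synthInstance.maxSize 2000 in
set_option synthInstance.maxHeartbeats 400000 in
theorem diagram_six : ∀ a b : Fin 6, gram 6 a b = -1 →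
    ∀ c, gram 6 b c = -1 → gram 6 a c = 0 → ∀ d, gram 6 c d = -1 → gram 6 b d = 0 →
    ∀ e, gram 6 d e = -1 → gram 6 c e = 0 →
    ∀ f, gram 6 c f = -1 → gram 6 b f = 0 → gram 6 d f = 0 →
    (a = 0 ∧ b = 1 ∧ c = 2 ∧ d = 3 ∧ e = 4 ∧ f = 5) ∨
      (a = 4 ∧ b = 3 ∧ c = 2 ∧ d = 1 ∧ e = 0 ∧ f = 5) := by
  decide +kernel

set_option synthInstance.maxSize 2000 in
set_option synthInstance.maxHeartbeats 400000 in
theorem diagram_seven : ∀ a b : Fin 7, gram 7 a b = -1 →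
    ∀ c, gram 7 b c = -1 → gram 7 a c = 0 → ∀ d, gram 7 c d = -1 → gram 7 b d = 0 →
    ∀ e, gram 7 d e = -1 → gram 7 c e = 0 → ∀ f, gram 7 e f = -1 → gram 7 d f = 0 →
    ∀ g, gram 7 c g = -1 → gram 7 b g = 0 → gram 7 d g = 0 →
    a = 0 ∧ b = 1 ∧ c = 2 ∧ d = 3 ∧ e = 4 ∧ f = 5 ∧ g = 6 := by
  decide +kernel

set_option synthInstance.maxSize 2000 in
set_option synthInstance.maxHeartbeats 400000 in
theorem diagram_eight : ∀ a b : Fin 8, gram 8 a b = -1 →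
    ∀ c, gram 8 b c = -1 → gram 8 a c = 0 → ∀ d, gram 8 c d = -1 → gram 8 b d = 0 →
    ∀ e, gram 8 d e = -1 → gram 8 c e = 0 → ∀ f, gram 8 e f = -1 → gram 8 d f = 0 →
    ∀ g, gram 8 f g = -1 → gram 8 e g = 0 →
    ∀ h, gram 8 c h = -1 → gram 8 b h = 0 → gram 8 d h = 0 →
    a = 0 ∧ b = 1 ∧ c = 2 ∧ d = 3 ∧ e = 4 ∧ f = 5 ∧ g = 6 ∧ h = 7 := by
  decide +kernel

theorem diagram_four_symm {σ : Fin 4 → Fin 4} (h : ∀ i j, gram 4 (σ i) (σ j) = gram 4 i j) :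
    σ = id ∨ σ = ![3, 2, 1, 0] := by
  obtain ⟨h0, h1, h2, h3⟩ | ⟨h0, h1, h2, h3⟩ := diagram_four (σ 0) (σ 1) (h _ _) (σ 2) (h _ _)
    (h _ _) (σ 3) (h _ _) (h _ _)
  · exact Or.inl (by funext i; fin_cases i <;> assumption)
  · exact Or.inr (by funext i; fin_cases i <;> assumption)

theorem diagram_five_symm {σ : Fin 5 → Fin 5} (h : ∀ i j, gram 5 (σ i) (σ j) = gram 5 i j) :
    σ = id ∨ σ = ![0, 1, 2, 4, 3] := by
  obtain ⟨h0, h1, h2, h3, h4⟩ | ⟨h0, h1, h2, h3, h4⟩ := diagram_five (σ 0) (σ 1) (h _ _) (σ 2)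
    (h _ _) (h _ _) (σ 3) (h _ _) (h _ _) (σ 4) (h _ _) (h _ _) (h _ _)
  · exact Or.inl (by funext i; fin_cases i <;> assumption)
  · exact Or.inr (by funext i; fin_cases i <;> assumption)

theorem diagram_six_symm {σ : Fin 6 → Fin 6} (h : ∀ i j, gram 6 (σ i) (σ j) = gram 6 i j) :
    σ = id ∨ σ = ![4, 3, 2, 1, 0, 5] := by
  obtain ⟨h0, h1, h2, h3, h4, h5⟩ | ⟨h0, h1, h2, h3, h4, h5⟩ := diagram_six (σ 0) (σ 1) (h _ _)
    (σ 2) (h _ _) (h _ _) (σ 3) (h _ _) (h _ _) (σ 4) (h _ _) (h _ _) (σ 5) (h _ _) (h _ _) (h _ _)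
  · exact Or.inl (by funext i; fin_cases i <;> assumption)
  · exact Or.inr (by funext i; fin_cases i <;> assumption)

theorem diagram_seven_symm {σ : Fin 7 → Fin 7} (h : ∀ i j, gram 7 (σ i) (σ j) = gram 7 i j) :
    σ = id := by
  obtain ⟨h0, h1, h2, h3, h4, h5, h6⟩ := diagram_seven (σ 0) (σ 1) (h _ _) (σ 2) (h _ _) (h _ _)
    (σ 3) (h _ _) (h _ _) (σ 4) (h _ _) (h _ _) (σ 5) (h _ _) (h _ _) (σ 6) (h _ _) (h _ _) (h _ _)
  funext i; fin_cases i <;> assumption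

theorem diagram_eight_symm {σ : Fin 8 → Fin 8} (h : ∀ i j, gram 8 (σ i) (σ j) = gram 8 i j) :
    σ = id := by
  obtain ⟨h0, h1, h2, h3, h4, h5, h6, h7⟩ := diagram_eight (σ 0) (σ 1) (h _ _) (σ 2) (h _ _)
    (h _ _) (σ 3) (h _ _) (h _ _) (σ 4) (h _ _) (h _ _) (σ 5) (h _ _) (h _ _) (σ 6) (h _ _) (h _ _)
    (σ 7) (h _ _) (h _ _) (h _ _)
  funext i; fin_cases i <;> assumption

/-! ### The Weyl group inside O(L) -/

theorem gram_of_apply_simpleBasis {n : ℕ} (h4 : 4 ≤ n) (hn : n ≤ 8) {u : orthL n}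
    {σ : Fin n → Fin n} (hσ : ∀ i, u.1 (simpleBasis h4 hn i) = simpleBasis h4 hn (σ i))
    (i j : Fin n) : gram n (σ i) (σ j) = gram n i j := by
  rw [gram, gram, ← form_simpleBasis h4 hn, ← form_simpleBasis h4 hn, ← hσ, ← hσ, u.2]

theorem weyl_eq_top {n : ℕ} (hn : n = 7 ∨ n = 8) : weyl n = ⊤ := by
  have h4 : 4 ≤ n := by omega
  have h8 : n ≤ 8 := by omega
  rw [eq_top_iff]
  intro u _
  obtain ⟨w, hw, σ, hσ⟩ := exists_weyl_mul_simpleBasis h4 h8 u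
  have hid : σ = id := by
    rcases hn with rfl | rfl
    · exact diagram_seven_symm (gram_of_apply_simpleBasis h4 h8 hσ)
    · exact diagram_eight_symm (gram_of_apply_simpleBasis h4 h8 hσ)
  subst hid
  have h1 : w * u = 1 := orthL_ext h4 h8 hσ
  rw [← inv_eq_of_mul_eq_one_right h1]
  exact inv_mem hw

/-- The Weyl group acts trivially on the discriminant group. -/
theorem weyl_apply_sub_mem {n : ℕ} {d : ℤ} {x : lattice n} (hx : ∀ v, d ∣ form n v x)
    {w : orthL n} (hw : w ∈ weyl n) : ∃ z : lattice n, w.1 x = x + d • z := by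
  induction hw using Subgroup.closure_induction_left with
  | one => exact ⟨0, by simp⟩
  | mul_left a ha w hw ih =>
    obtain ⟨a, rfl⟩ := ha
    obtain ⟨z, hz⟩ := ih
    obtain ⟨k, hk⟩ := hx a
    refine ⟨-k • (a : lattice n) + (rootReflection n a).1 z, ?_⟩
    change (rootReflection n a).1 (w.1 x) = _
    rw [hz, map_add, map_smul, rootReflection_apply n a x, hk]
    module
  | inv_mul_cancel a ha w hw ih =>
    obtain ⟨a, rfl⟩ := ha
    obtain ⟨z, hz⟩ := ih
    obtain ⟨k, hk⟩ := hx a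
    have hinv : (rootReflection n a)⁻¹ = rootReflection n a := by
      rw [inv_eq_iff_mul_eq_one]
      refine Subtype.ext (LinearEquiv.ext fun v => ?_)
      exact Module.involutive_reflection (show form n (a : lattice n) (a : lattice n) = 2 from a.2) v
    rw [hinv]
    refine ⟨-k • (a : lattice n) + (rootReflection n a).1 z, ?_⟩
    change (rootReflection n a).1 (w.1 x) = _
    rw [hz, map_add, map_smul, rootReflection_apply n a x, hk]
    module

/-- The vector x = (9 - n)E_1 - K lies in L and has all its products with L divisible by 9 - n. If
-1 were in W, then -x ≡ x mod (9 - n)L; the coordinate of x at E_2 is 1, so 9 - n ≥ 3 would divide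
2. -/
theorem negOne_notMem_weyl {n : ℕ} (h4 : 4 ≤ n) (hn : n ≤ 6) : negOne n ∉ weyl n := by
  intro hw
  let e : Fin (n + 1) → ℤ := fun k => if k.val = 1 then 1 else 0
  have hL : (9 - n : ℤ) • e - K n ∈ lattice n := by
    rw [mem_lattice_iff]
    simp only [e, K]
    interval_cases n <;> decide +kernel
  obtain ⟨z, hz⟩ := weyl_apply_sub_mem (d := 9 - n) (x := ⟨_, hL⟩) (fun v => by
    have h1 : lorentz n (K n) v = 0 := v.2
    rw [form_apply, map_sub, lorentz_comm _ _ (K _), h1, sub_zero, map_smul, smul_eq_mul]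
    exact dvd_mul_right _ _) hw
  have h1 := congrFun (congrArg Subtype.val hz) ⟨2, by omega⟩
  have h2 : -((9 - n : ℤ) * 0 - -1) = (9 - n : ℤ) * 0 - -1 + (9 - n : ℤ) * z.1 ⟨2, by omega⟩ := h1
  have h6 : (9 - n : ℤ) ∣ 2 := ⟨-z.1 ⟨2, by omega⟩, by linarith⟩
  have := Int.le_of_dvd two_pos h6
  omega

theorem rho_negOne_mul {n : ℕ} (u : orthL n) : rho n (negOne n * u) = rho n u :=
  ((rho n).map_mul _ _).trans ((congrArg (· * rho n u) (rho_negOne n)).trans (one_mul _))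

/-- As -1 is not in W, it induces the nontrivial diagram symmetry modulo W. An isometry u inducing
the trivial symmetry lies in W; otherwise u and -1 induce the same one, and -u lies in W. -/
theorem mem_weyl_or_negOne_mul_mem_weyl {n : ℕ} (hn : n = 4 ∨ n = 5 ∨ n = 6) (u : orthL n) :
    u ∈ weyl n ∨ negOne n * u ∈ weyl n := by
  have h4 : 4 ≤ n := by omega
  have h8 : n ≤ 8 := by omega
  obtain ⟨w, hw, σ, hσ⟩ := exists_weyl_mul_simpleBasis h4 h8 u
  obtain ⟨w', hw', τ, hτ⟩ := exists_weyl_mul_simpleBasis h4 h8 (negOne n)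
  have hid : ∀ w ∈ weyl n, ∀ u : orthL n,
      (∀ i, (w * u).1 (simpleBasis h4 h8 i) = simpleBasis h4 h8 (id i)) → u ∈ weyl n := by
    intro w hw u h
    have h1 : w * u = 1 := orthL_ext h4 h8 h
    rw [← inv_eq_of_mul_eq_one_right h1]
    exact inv_mem hw
  have hdiag : ∃ ω : Fin n → Fin n, (σ = id ∨ σ = ω) ∧ (τ = id ∨ τ = ω) := by
    have h1 := gram_of_apply_simpleBasis h4 h8 hσ
    have h2 := gram_of_apply_simpleBasis h4 h8 hτ
    rcases hn with rfl | rfl | rfl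
    · exact ⟨_, diagram_four_symm h1, diagram_four_symm h2⟩
    · exact ⟨_, diagram_five_symm h1, diagram_five_symm h2⟩
    · exact ⟨_, diagram_six_symm h1, diagram_six_symm h2⟩
  obtain ⟨ω, rfl | rfl, rfl | rfl⟩ := hdiag
  · exact Or.inl (hid w hw u hσ)
  · exact Or.inl (hid w hw u hσ)
  · exact absurd (hid w' hw' _ hτ) (negOne_notMem_weyl h4 (by omega))
  · right
    have h1 : w * u = w' * negOne n := orthL_ext h4 h8 fun i => (hσ i).trans (hτ i).symm
    have h2 : negOne n * w'⁻¹ * w = u⁻¹ := by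
      rw [eq_inv_iff_mul_eq_one, mul_assoc, h1, mul_assoc, inv_mul_cancel_left, negOne_mul_self]
    have h3 : negOne n * u = (w⁻¹ * w') := by
      rw [← inv_inv u, ← h2]
      have h5 : (negOne n)⁻¹ = negOne n := inv_eq_of_mul_eq_one_left (negOne_mul_self n)
      rw [mul_inv_rev, mul_inv_rev, h5, inv_inv]
      have h6 : ∀ v : orthL n, negOne n * v * negOne n = v := by
        intro v
        ext x
        simp [negOne]
      rw [← mul_assoc, ← mul_assoc, mul_assoc (negOne n), h6]
    rw [h3]
    exact mul_mem (inv_mem hw) hw'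

theorem eq_one_of_mem_weyl_of_rho_eq_one {n : ℕ} (h4 : 4 ≤ n) (hn : n ≤ 6) (w : orthL n)
    (hw : w ∈ weyl n) (h : rho n w = 1) : w = 1 :=
  (eq_one_or_eq_negOne_of_rho_eq_one h4 (by omega) h).resolve_right fun h' =>
    negOne_notMem_weyl h4 hn (h' ▸ hw)

theorem exists_mulEquiv_of_subgroup {G H : Type*} [Group G] [Group H] (f : G →* H)
    (W : Subgroup G) (hinj : ∀ w ∈ W, f w = 1 → w = 1) (hsurj : ∀ g, ∃ w ∈ W, f w = g) :
    ∃ φ : W ≃* H, ∀ w : W, φ w = f w := by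
  refine ⟨MulEquiv.ofBijective (f.comp W.subtype) ⟨?_, fun g => ?_⟩, fun w => rfl⟩
  · rw [injective_iff_map_eq_one]
    exact fun w hw => Subtype.ext (hinj w w.2 hw)
  · obtain ⟨w, hw, h⟩ := hsurj g
    exact ⟨⟨w, hw⟩, h⟩

theorem exists_quotient_mulEquiv_of_subgroup {G H : Type*} [Group G] [Group H] (f : G →* H)
    (W N : Subgroup G) [N.Normal] (hker : ∀ g, f g = 1 ↔ g ∈ N)
    (hsurj : ∀ g, ∃ w ∈ W, f w = g) :
    ∃ φ : W ⧸ N.subgroupOf W ≃* H, ∀ w : W, φ (QuotientGroup.mk w) = f w := by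
  refine ⟨QuotientGroup.liftEquiv _ (φ := f.comp W.subtype) (fun g => ?_)
    (Subgroup.ext fun w => (hker w).symm), fun w => rfl⟩
  obtain ⟨w, hw, h⟩ := hsurj g
  exact ⟨⟨w, hw⟩, h⟩

end DelPezzo

theorem mainTheorem3 :
    (∀ n : ℕ, n = 4 ∨ n = 5 ∨ n = 6 →
      ∃ φ : DelPezzo.weyl n ≃* DelPezzo.orthL2 n,
        ∀ w : DelPezzo.weyl n, φ w = DelPezzo.rho n (w : DelPezzo.orthL n)) ∧
    (∀ n : ℕ, n = 7 ∨ n = 8 →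
      DelPezzo.pmOne n ≤ DelPezzo.weyl n ∧
      ∃ φ : DelPezzo.weyl n ⧸ (DelPezzo.pmOne n).subgroupOf (DelPezzo.weyl n) ≃*
          DelPezzo.orthL2 n,
        ∀ w : DelPezzo.weyl n,
          φ (QuotientGroup.mk w) = DelPezzo.rho n (w : DelPezzo.orthL n)) := by
  refine ⟨fun n hn => ?_, fun n hn => ⟨DelPezzo.weyl_eq_top hn ▸ le_top, ?_⟩⟩
  · have h4 : 4 ≤ n := by omega
    have h8 : n ≤ 8 := by omega
    exact DelPezzo.exists_mulEquiv_of_subgroup (DelPezzo.rho n) (DelPezzo.weyl n)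
      (DelPezzo.eq_one_of_mem_weyl_of_rho_eq_one h4 (by omega))
      (fun g => (DelPezzo.rho_surjective h4 h8 g).elim fun u hu =>
        (DelPezzo.mem_weyl_or_negOne_mul_mem_weyl hn u).elim (fun h => ⟨u, h, hu⟩)
          fun h => ⟨_, h, (DelPezzo.rho_negOne_mul u).trans hu⟩)
  · have h4 : 4 ≤ n := by omega
    have h8 : n ≤ 8 := by omega
    exact DelPezzo.exists_quotient_mulEquiv_of_subgroup (DelPezzo.rho n) (DelPezzo.weyl n)
      (DelPezzo.pmOne n) (DelPezzo.rho_eq_one_iff h4 h8)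
      (fun g => (DelPezzo.rho_surjective h4 h8 g).elim fun u hu =>
        ⟨u, DelPezzo.weyl_eq_top hn ▸ Subgroup.mem_top u, hu⟩)
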